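/- Let $\mathcal M$ be a structural causal model with finitely many endogenous variables $X_v$, $v\in D$, taking values in standard Borel spaces, with mutually independent exogenous variables $U_v$, a directed acyclic graph $\mathcal G$ on $D$, and structural equations $X_v=f_v(X_{\mathrm{pa}(v)},U_v)$. Let $Y=X_y$ be an endogenous variable (the target) and $O\subseteq D\setminus\{y\}$ the set of observed variables. Let $C\subseteq D$ be the set of (direct or indirect) endogenous causes of $Y$, i.e. the $v$ with a nonempty directed path from $v$ to $y$. Suppose that all endogenous direct causes of $Y$, all direct children of $Y$ and all spouses of $Y$ (vertices $\neq y$ that share a direct child with $y$) belong to $O$. A graphical Markov blanket of $Y$ is an inclusion-minimal $B\subseteq O$ such that $B$ $d$-separates $O\setminus B$ from $y$ in $\mathcal G$. A (probabilistic) Markov blanket of $Y$ is an inclusion-minimal $B\subseteq O$ such that $X_O$ is conditionally independent of $Y$ given $X_B$. For $I\subseteq D$ the augmented graph $\mathcal G^*$ is $\mathcal G$ with one additional parentless vertex $\mathcal I_l$ and one additional edge $\mathcal I_l\to l$ for every $l\in I$; $B$ is intervention stable with respect to interventions on $I$ if, for every $l\in I$, $\mathcal I_l$ and $y$ are $d$-separated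 by $B$ in $\mathcal G^*$. We say that $P(Y\mid X_B)$ is invariant under a set of actions $a=do(\{X_i:=a_i\}_{i\in I_a})$ if one and the same Markov kernel is a conditional distribution of $Y$ given $X_B$ in the model resulting from each of these actions. Then: (1) If $B$ is a graphical Markov blanket of $Y$, then $B$ is intervention stable with respect to interventions on any set $I\subseteq C$, and $P(Y\mid X_B)$ is invariant under all actions $a$ with $I_a\subseteq C$. (2) If $\mathcal M$ is faithful (every conditional independence $X_A\perp X_{A'}\mid X_Z$ with $A,A',Z\subseteq D$ pairwise disjoint comes from a $d$-separation in $\mathcal G$), then the same two conclusions hold for every probabilistic Markov blanket $B$ of $Y$. (3) Without faithfulness, if $B$ is a probabilistic Markov blanket of $Y$, then $P(Y\mid X_B)$ is invariant under all actions $a$ with $I_a\subseteq C$ for which the law of $X_O$ after the action is absolutely continuous with respect to the law of $X_O$ before the action. -/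

import Mathlib

open MeasureTheory ProbabilityTheory

/-! ### Directed graphs, d-separation, intervention variables -/

namespace CausalGraph

variable {V : Type*}

/-- Direct causes (parents) of `y`. -/
def directCauses (G : Digraph V) (y : V) : Set V := {v | G.Adj v y}

/-- Direct children (direct effects) of `y`. -/
def directChildren (G : Digraph V) (y : V) : Set V := {v | G.Adj y v}

/-- Spouses of `y`: the vertices other than `y` that share a direct child with `y`. -/
def spouses (G : Digraph V) (y : V) : Set V := {v | v ≠ y ∧ ∃ c, G.Adj y c ∧ G.Adj v c}

/-- Causes of `y`, direct or indirect: the vertices with a nonempty directed path to `y`. -/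
def causes (G : Digraph V) (y : V) : Set V := {v | Relation.TransGen G.Adj v y}

/-- `G` has no directed cycle. -/
def Acyclic (G : Digraph V) : Prop := ∀ v, ¬ Relation.TransGen G.Adj v v

/-- `p` is an undirected path from `x` to `y`: it has no repeated vertex, and consecutive vertices
are joined by an edge in one of the two directions. -/
def IsPath (G : Digraph V) (x y : V) (p : List V) : Prop :=
  p.head? = some x ∧ p.getLast? = some y ∧ p.Nodup ∧
    p.IsChain (fun u v => G.Adj u v ∨ G.Adj v u)

/-- The path `p` is blocked by `Z`: it contains three consecutive vertices `i, m, j` that form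
a chain (in either direction) or a fork with `m ∈ Z`, or a collider such that neither `m`
nor any descendant of `m` lies in `Z`. -/
def Blocked (G : Digraph V) (Z : Set V) (p : List V) : Prop :=
  ∃ i m j, [i, m, j] <:+: p ∧
    ((((G.Adj i m ∧ G.Adj m j) ∨ (G.Adj j m ∧ G.Adj m i) ∨ (G.Adj m i ∧ G.Adj m j)) ∧ m ∈ Z) ∨
      ((G.Adj i m ∧ G.Adj j m) ∧ ∀ n, Relation.ReflTransGen G.Adj m n → n ∉ Z))

/-- `A` and `B` are d-separated by `Z` in `G`. Meant for pairwise disjoint sets. -/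
def DSep (G : Digraph V) (A B Z : Set V) : Prop :=
  ∀ x ∈ A, ∀ y ∈ B, ∀ p, IsPath G x y p → Blocked G Z p

/-- The augmented graph: for every `l ∈ I` a parentless intervention variable `Sum.inr l` is added,
with `l` as its only direct effect. -/
def augmented (G : Digraph V) (I : Set V) : Digraph (V ⊕ I) where
  Adj
    | .inl u, .inl v => G.Adj u v
    | .inr l, .inl v => (l : V) = v
    | _, .inr _ => False

/-- `S` is intervention stable (for the target `y`) with respect to interventions on `I`: in the
augmented graph every intervention variable is d-separated from `y` by `S`. -/
def InterventionStable (G : Digraph V) (I : Set V) (y : V) (S : Set V) : Prop :=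
  ∀ l : I, DSep (augmented G I) {Sum.inr l} {Sum.inl y} (Sum.inl '' S)

/-- `B` is a graphical Markov blanket of `y` among the observed variables `O`: a minimal subset of
`O` that d-separates the remaining observed variables from `y`. -/
def IsGraphicalMarkovBlanket (G : Digraph V) (O : Set V) (y : V) (B : Set V) : Prop :=
  Minimal (fun B : Set V => B ⊆ O ∧ DSep G (O \ B) {y} B) B

end CausalGraph

/-! ### Structural causal models -/

/-- A structural causal model with endogenous variables `X v ∈ 𝒳 v`, exogenous variables
`U v ∈ 𝒰 v` (mutually independent, `U v` with law `noise v`), a directed acyclic graph, and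
structural equations `X v = f v (X u : u direct cause of v) (U v)`. -/
structure SCM {V : Type*} (𝒳 𝒰 : V → Type*) [∀ v, MeasurableSpace (𝒳 v)]
    [∀ v, MeasurableSpace (𝒰 v)] where
  graph : Digraph V
  acyclic : CausalGraph.Acyclic graph
  f : ∀ v, (∀ u : CausalGraph.directCauses graph v, 𝒳 u) → 𝒰 v → 𝒳 v
  measurable_f : ∀ v, Measurable (fun q : (∀ u : CausalGraph.directCauses graph v, 𝒳 u) × 𝒰 v =>
    f v q.1 q.2)
  noise : ∀ v, Measure (𝒰 v)
  isProbabilityMeasure_noise : ∀ v, IsProbabilityMeasure (noise v)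

/-- An action `do(X_i := a_i, i ∈ I)`. -/
structure DoAction {V : Type*} (𝒳 : V → Type*) where
  targets : Set V
  value : ∀ i : targets, 𝒳 i

namespace SCM

variable {V : Type*} {𝒳 𝒰 : V → Type*} [∀ v, MeasurableSpace (𝒳 v)] [∀ v, MeasurableSpace (𝒰 v)]

attribute [instance] SCM.isProbabilityMeasure_noise

open Classical in
/-- The model after the action `a`: the structural equations of the targets are replaced by
constants (and their incoming edges removed), all else is unchanged. -/
noncomputable def act (M : SCM 𝒳 𝒰) (a : DoAction 𝒳) : SCM 𝒳 𝒰 where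
  graph := ⟨fun u v => M.graph.Adj u v ∧ v ∉ a.targets⟩
  acyclic v h := M.acyclic v (Relation.TransGen.mono (fun _ _ h => h.1) v v h)
  f v pa u :=
    if h : v ∈ a.targets then a.value ⟨v, h⟩ else M.f v (fun w => pa ⟨w, w.2, h⟩) u
  measurable_f v := by
    by_cases h : v ∈ a.targets
    · simp only [h, dite_true]
      exact measurable_const
    · simp only [h, dite_false]
      refine (M.measurable_f v).comp (Measurable.prodMk ?_ measurable_snd)
      exact measurable_pi_lambda _ fun w => (measurable_pi_apply _).comp measurable_fst
  noise := M.noise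
  isProbabilityMeasure_noise := M.isProbabilityMeasure_noise

theorem measurable_domRestrict (C : Set V) : Measurable (Set.domRestrict (π := 𝒳) C) :=
  measurable_pi_lambda _ fun v => measurable_pi_apply (v : V)

variable [Fintype V]

theorem wellFounded_adj (M : SCM 𝒳 𝒰) : WellFounded M.graph.Adj := by
  have : Std.Irrefl (Relation.TransGen M.graph.Adj) := ⟨M.acyclic⟩
  have h : WellFounded (Relation.TransGen M.graph.Adj) :=
    Finite.wellFounded_of_trans_of_irrefl _
  exact Subrelation.wf (fun h => Relation.TransGen.single h) h

/-- The solution of the structural equations: the endogenous variables as functions of the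
exogenous ones. -/
noncomputable def solve (M : SCM 𝒳 𝒰) (u : ∀ v, 𝒰 v) : ∀ v, 𝒳 v :=
  M.wellFounded_adj.fix fun v rec => M.f v (fun w => rec w w.2) (u v)

theorem solve_eq (M : SCM 𝒳 𝒰) (u : ∀ v, 𝒰 v) (v : V) :
    M.solve u v = M.f v (fun w => M.solve u w) (u v) :=
  M.wellFounded_adj.fix_eq _ v

theorem measurable_solve (M : SCM 𝒳 𝒰) : Measurable M.solve := by
  refine measurable_pi_lambda _ fun v => ?_
  induction v using M.wellFounded_adj.induction with
  | _ v ih =>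
    simp_rw [M.solve_eq _ v]
    refine (M.measurable_f v).comp (Measurable.prodMk ?_ (measurable_pi_apply v))
    exact measurable_pi_lambda _ fun w => ih w w.2

/-- The law of the endogenous variables entailed by the model. -/
noncomputable def law (M : SCM 𝒳 𝒰) : Measure (∀ v, 𝒳 v) :=
  (Measure.pi M.noise).map M.solve

instance (M : SCM 𝒳 𝒰) : IsProbabilityMeasure M.law :=
  Measure.isProbabilityMeasure_map M.measurable_solve.aemeasurable

/-- Under the model, `X_A` and `X_B` are conditionally independent given `X_C`. -/
def CondIndep [∀ v, StandardBorelSpace (𝒳 v)] (M : SCM 𝒳 𝒰) (A B C : Set V) : Prop :=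
  CondIndepFun (MeasurableSpace.comap (Set.domRestrict (π := 𝒳) C) inferInstance)
    (measurable_domRestrict C).comap_le (Set.domRestrict (π := 𝒳) A) (Set.domRestrict (π := 𝒳) B) M.law

/-- `B` is a Markov blanket of `X_y` among the observed variables `O`: a minimal subset of `O`
such that `X_O` and `X_y` are conditionally independent given `X_B`. -/
def IsMarkovBlanket [∀ v, StandardBorelSpace (𝒳 v)] (M : SCM 𝒳 𝒰) (O : Set V) (y : V)
    (B : Set V) : Prop :=
  Minimal (fun B : Set V => B ⊆ O ∧ M.CondIndep O {y} B) B

/-- Faithfulness: every conditional independence among disjoint sets of endogenous variables comes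
from a d-separation in the graph. -/
def Faithful [∀ v, StandardBorelSpace (𝒳 v)] (M : SCM 𝒳 𝒰) : Prop :=
  ∀ A B C : Set V, Disjoint A B → Disjoint A C → Disjoint B C →
    M.CondIndep A B C → CausalGraph.DSep M.graph A B C

/-- `P(X_y | X_S)` is invariant under the actions in `𝒜`: one and the same Markov kernel is a
conditional distribution of `X_y` given `X_S` under each of these actions. -/
def InvariantConditional (M : SCM 𝒳 𝒰) (𝒜 : Set (DoAction 𝒳)) (y : V) (S : Set V) : Prop :=
  ∃ κ : Kernel (∀ s : S, 𝒳 s) (𝒳 y), IsMarkovKernel κ ∧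
    ∀ a ∈ 𝒜, HasCondDistrib (fun x : ∀ v, 𝒳 v => x y) (Set.domRestrict (π := 𝒳) S) κ (M.act a).law

end SCM

/-!
Let `Bl` be the set of parents, children and spouses of `y`, all of which are observed.

*Graph.* A parent or child of `y` cannot be separated from `y`, and once the children are in the
separating set, the path `v → c ← y` keeps a spouse `v` connected to `y`. So every separating set
contains `Bl` (`markovBlanket_subset_of_dSep`). Conversely `Bl` blocks every path that reaches `y`
from outside `Bl` (`blocked_markovBlanket`), hence `Bl` is the only graphical Markov blanket. An
intervention variable attached to a cause of `y` points neither to `y` nor to a child of `y`, so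
`Bl` remains the blanket in the augmented graph and `y` is separated from this variable.

*Probability.* The core is `exists_kernel_markovBlanket`: a single kernel that depends on the
coordinates in `Bl` only is a conditional distribution of `X_y` given all other variables, in
every model with at most the same edges and the same mechanisms at `y` and at its children. No
densities are available, so it is built as a sequential posterior along a topological order. It
starts as the mechanism of `y` given its causes. A new variable that is not a child of `y` is
generated from the past without `X_y` and leaves the posterior unchanged. A new child `v` has a
mechanism that depends on `X_y` and on spouses of `y`; the joint conditional law of
`(X_v, X_y)` is a function of the part of `Bl` seen so far and is disintegrated with respect to
`X_v`. An action on causes of `y` keeps the mechanisms of `y` and its children, so the kernel serves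
all such actions at once. This is the invariance of `P(X_y | X_Bl)`; it also gives
`X_O ⊥ X_y | X_Bl`.

In a faithful model a probabilistic Markov blanket `B` separates `O \ B` from `y`, so it contains
`Bl`, and by minimality it equals `Bl`. Without faithfulness, the conditional distributions given
`X_B` and given `X_Bl` are both versions of the one given `X_O`; they agree almost surely before
the action and, by absolute continuity, after it.
-/

/-! ### Separation by parents, children and spouses -/

namespace CausalGraph

variable {V : Type*}

/-- The parents, children and spouses of `y`, a purely graphical notion: no observed set and no
minimality enter. `y` itself is excluded only through acyclicity. -/
def markovBlanket (G : Digraph V) (y : V) : Set V :=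
  directCauses G y ∪ directChildren G y ∪ spouses G y

theorem Acyclic.not_adj {G : Digraph V} (hG : Acyclic G) {u v : V} (h : G.Adj u v) :
    ¬ G.Adj v u := fun h' => hG u (.tail (.single h) h')

theorem Acyclic.ne {G : Digraph V} (hG : Acyclic G) {u v : V} (h : G.Adj u v) : u ≠ v := by
  rintro rfl; exact hG u (.single h)

theorem Acyclic.not_mem_causes {G : Digraph V} (hG : Acyclic G) (y : V) : y ∉ causes G y :=
  hG y

theorem Acyclic.child_not_mem_causes {G : Digraph V} (hG : Acyclic G) {y c : V}
    (h : G.Adj y c) : c ∉ causes G y := fun hc => hG y (.head h hc)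

theorem directCauses_subset_causes (G : Digraph V) (y : V) : directCauses G y ⊆ causes G y :=
  fun _ h => .single h

theorem not_mem_markovBlanket {G : Digraph V} (hG : Acyclic G) (y : V) :
    y ∉ markovBlanket G y := by
  rintro ((h | h) | h)
  · exact hG.ne h rfl
  · exact hG.ne h rfl
  · exact h.1 rfl

/-- Parents, children and spouses of `y` block every path that arrives at `y` from elsewhere:
if the last edge leaves a parent or arrives from a child that is not a collider, that neighbour
blocks the path; if the child is a collider, the vertex before it is a spouse, which is then not
a collider. -/
theorem blocked_markovBlanket {G : Digraph V} {x y : V} (hxy : x ≠ y)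
    (hx : x ∉ markovBlanket G y) {p : List V} (hp : IsPath G x y p) :
    Blocked G (markovBlanket G y) p := by
  obtain ⟨l, rfl⟩ : ∃ l, p = l.reverse := ⟨p.reverse, by simp⟩
  obtain ⟨hhead, hlast, hnd, hch⟩ := hp
  rw [List.head?_reverse] at hhead
  rw [List.getLast?_reverse] at hlast
  rw [List.nodup_reverse] at hnd
  rw [List.isChain_reverse] at hch
  match l with
  | [] => simp at hhead
  | [a] => simp_all
  | [a, m] =>
    simp only [List.getLast?_cons_cons, List.getLast?_singleton, Option.some.injEq,
      List.head?_cons, List.isChain_cons_cons] at hhead hlast hch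
    subst hhead hlast
    rcases hch.1 with h | h
    · exact absurd (Or.inl (Or.inl h)) hx
    · exact absurd (Or.inl (Or.inr h)) hx
  | a :: m :: i :: r =>
    simp only [List.head?_cons, Option.some.injEq] at hlast
    subst hlast
    have hin : [i, m, a] <:+: (a :: m :: i :: r).reverse := ⟨r.reverse, [], by simp⟩
    simp only [List.isChain_cons_cons] at hch
    rcases hch with ⟨hma | ham, him, hch⟩
    · have hm : m ∈ markovBlanket G a := Or.inl (Or.inl hma)
      refine ⟨i, m, a, hin, Or.inl ⟨?_, hm⟩⟩
      tauto
    · have hm : m ∈ markovBlanket G a := Or.inl (Or.inr ham)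
      rcases him with him | hmi
      · have hi : i ∈ markovBlanket G a := by
          refine Or.inr ⟨?_, m, ham, him⟩
          rintro rfl
          simp at hnd
        match r with
        | [] => simp_all
        | h :: r =>
          simp only [List.isChain_cons_cons] at hch
          refine ⟨h, i, m, ⟨r.reverse, [a], by simp⟩, Or.inl ⟨?_, hi⟩⟩
          tauto
      · exact ⟨i, m, a, hin, Or.inl ⟨Or.inr (Or.inl ⟨ham, hmi⟩), hm⟩⟩

theorem dSep_markovBlanket (G : Digraph V) (y : V) {A : Set V} (hy : y ∉ A)
    (hA : Disjoint A (markovBlanket G y)) : DSep G A {y} (markovBlanket G y) := by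
  rintro x hx z rfl p hp
  exact blocked_markovBlanket (by rintro rfl; exact hy hx) (Set.disjoint_left.1 hA hx) hp

/-- Neighbours of `y` cannot be separated from `y`, and once the children are conditioned on,
neither can the spouses. -/
theorem markovBlanket_subset_of_dSep {G : Digraph V} (hG : Acyclic G) {y : V} {O B : Set V}
    (hO : markovBlanket G y ⊆ O) (h : DSep G (O \ B) {y} B) : markovBlanket G y ⊆ B := by
  have edge : ∀ v, v ∈ O → (G.Adj v y ∨ G.Adj y v) → v ∈ B := by
    intro v hv ha
    by_contra hvB
    have hne : v ≠ y := by rcases ha with ha | ha; exacts [hG.ne ha, (hG.ne ha).symm]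
    obtain ⟨i, m, j, hin, -⟩ := h v ⟨hv, hvB⟩ y rfl [v, y] ⟨rfl, rfl, by simpa, by simpa⟩
    simpa using hin.length_le
  have nbr : ∀ v, (G.Adj v y ∨ G.Adj y v) → v ∈ B := fun v ha =>
    edge v (hO (ha.elim (fun h => Or.inl (Or.inl h)) fun h => Or.inl (Or.inr h))) ha
  rintro v ((hv | hv) | hv)
  · exact nbr v (Or.inl hv)
  · exact nbr v (Or.inr hv)
  · by_contra hvB
    have hvO := hO (Or.inr hv)
    obtain ⟨hne, c, hyc, hvc⟩ := hv
    have hcB := nbr c (Or.inr hyc)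
    obtain ⟨i, m, j, hin, hb⟩ := h v ⟨hvO, hvB⟩ y rfl [v, c, y]
      ⟨rfl, rfl, by simp [hne, hG.ne hvc, (hG.ne hyc).symm], by simp [hvc, hyc]⟩
    have heq := hin.eq_of_length (by simp)
    simp only [List.cons.injEq, and_true] at heq
    obtain ⟨rfl, rfl, rfl⟩ := heq
    rcases hb with ⟨⟨-, h2⟩ | ⟨-, h2⟩ | ⟨h1, -⟩, -⟩ | ⟨-, h2⟩
    · exact hG.not_adj hyc h2
    · exact hG.not_adj hvc h2
    · exact hG.not_adj hvc h1
    · exact h2 _ .refl hcB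

theorem IsGraphicalMarkovBlanket.eq_markovBlanket {G : Digraph V} (hG : Acyclic G) {y : V}
    {O B : Set V} (hy : y ∉ O) (hO : markovBlanket G y ⊆ O)
    (hB : IsGraphicalMarkovBlanket G O y B) : B = markovBlanket G y := by
  have hsub := markovBlanket_subset_of_dSep hG hO hB.prop.2
  exact (hB.le_of_le ⟨hO, dSep_markovBlanket G y (fun h => hy h.1) Set.disjoint_sdiff_left⟩
    hsub).antisymm hsub

/-- Intervention variables on causes of `y` do not enlarge its Markov blanket: they are parents
neither of `y` nor, by acyclicity, of a child of `y`. -/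
theorem markovBlanket_augmented {G : Digraph V} (hG : Acyclic G) {y : V} {I : Set V}
    (hI : I ⊆ causes G y) :
    markovBlanket (augmented G I) (Sum.inl y) = Sum.inl '' markovBlanket G y := by
  ext (v | l)
  · simp only [markovBlanket, directCauses, directChildren, spouses, augmented, Set.mem_union,
      Set.mem_ofPred_eq, Set.mem_image, Sum.inl.injEq, exists_eq_right, ne_eq, Sum.exists,
      and_false, exists_false, or_false]
  · simp only [Set.mem_image, reduceCtorEq, and_false, exists_false, iff_false]
    rintro ((h | h) | ⟨-, c | c, h1, h2⟩)
    · have hl : (l : V) = y := h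
      exact hG.not_mem_causes y (hl ▸ hI l.2)
    · exact h
    · have hl : (l : V) = c := h2
      exact hG.child_not_mem_causes h1 (hl ▸ hI l.2)
    · exact h1

theorem interventionStable_markovBlanket {G : Digraph V} (hG : Acyclic G) {y : V} {I : Set V}
    (hI : I ⊆ causes G y) : InterventionStable G I y (markovBlanket G y) := by
  intro l
  rw [← markovBlanket_augmented hG hI]
  refine dSep_markovBlanket _ _ (by simp) ?_
  rw [markovBlanket_augmented hG hI]
  simp

end CausalGraph

/-! ### Conditional distributions -/

namespace ProbabilityTheory

variable {Ω 𝓧 𝓨 𝓩 𝓦 : Type*} {mΩ : MeasurableSpace Ω} {m𝓧 : MeasurableSpace 𝓧}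
  {m𝓨 : MeasurableSpace 𝓨} {m𝓩 : MeasurableSpace 𝓩} {m𝓦 : MeasurableSpace 𝓦}
  {P : Measure Ω} {X : Ω → 𝓧} {Y : Ω → 𝓨} {W : Ω → 𝓦}

/-- Coarsening: a conditional distribution of `Y` given `X` that factors almost surely through
`ψ ∘ X` is a conditional distribution given `ψ ∘ X`. -/
theorem HasCondDistrib.of_comp [SFinite P] {κ : Kernel 𝓧 𝓨} [IsSFiniteKernel κ]
    {κ' : Kernel 𝓩 𝓨} [IsSFiniteKernel κ'] (h : HasCondDistrib Y X κ P) {ψ : 𝓧 → 𝓩}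
    (hψ : Measurable ψ) (hκ : ∀ᵐ ω ∂P, κ' (ψ (X ω)) = κ (X ω)) :
    HasCondDistrib Y (fun ω => ψ (X ω)) κ' P where
  map_eq := by
    have hX := h.aemeasurable_fst
    have hY := h.aemeasurable_snd
    calc P.map (fun ω ↦ (ψ (X ω), Y ω))
        = (P.map (fun ω ↦ (X ω, Y ω))).map (Prod.map ψ id) := by
          rw [AEMeasurable.map_map_of_aemeasurable (by fun_prop) (by fun_prop)]
          rfl
      _ = (P.map X ⊗ₘ κ).map (Prod.map ψ id) := by rw [h.map_eq]
      _ = P.map (fun ω => ψ (X ω)) ⊗ₘ κ' := by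
          ext s hs
          have hs' : MeasurableSet (Prod.map ψ id ⁻¹' s : Set (𝓧 × 𝓨)) :=
            (hψ.prodMap measurable_id) hs
          rw [Measure.map_apply (by fun_prop) hs, Measure.compProd_apply hs',
            Measure.compProd_apply hs,
            lintegral_map' (Kernel.measurable_kernel_prodMk_left hs').aemeasurable hX,
            lintegral_map' (f := fun z => κ' z (Prod.mk z ⁻¹' s))
              (Kernel.measurable_kernel_prodMk_left hs).aemeasurable (hψ.comp_aemeasurable' hX)]
          refine lintegral_congr_ae ?_
          filter_upwards [hκ] with ω hω
          rw [hω]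
          rfl

/-- The chain rule for conditional distributions. -/
theorem HasCondDistrib.compProd [SFinite P] {κ : Kernel 𝓧 𝓨} [IsSFiniteKernel κ]
    {η : Kernel (𝓧 × 𝓨) 𝓦} [IsSFiniteKernel η] (hY : HasCondDistrib Y X κ P)
    (hW : HasCondDistrib W (fun ω => (X ω, Y ω)) η P) :
    HasCondDistrib (fun ω => (Y ω, W ω)) X (κ ⊗ₖ η) P where
  aemeasurable := by
    have := hY.aemeasurable_fst
    have := hY.aemeasurable_snd
    have := hW.aemeasurable_snd
    fun_prop
  map_eq := by
    have h1 := hY.aemeasurable_fst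
    have h2 := hY.aemeasurable_snd
    have h3 := hW.aemeasurable_snd
    calc P.map (fun ω => (X ω, Y ω, W ω))
        = (P.map (fun ω => ((X ω, Y ω), W ω))).map MeasurableEquiv.prodAssoc := by
          rw [AEMeasurable.map_map_of_aemeasurable (by fun_prop) (by fun_prop)]
          rfl
      _ = P.map X ⊗ₘ (κ ⊗ₖ η) := by
          rw [hW.map_eq, hY.map_eq, ← Measure.compProd_assoc, Measure.map_map
            (by fun_prop) (by fun_prop)]
          simp

theorem Kernel.compProd_prodMkRight (κ : Kernel 𝓧 𝓨) [IsSFiniteKernel κ] (η : Kernel 𝓧 𝓦)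
    [IsSFiniteKernel η] : κ ⊗ₖ η.prodMkRight 𝓨 = κ ×ₖ η := by
  ext x s hs
  rw [Kernel.compProd_apply hs, Kernel.prod_apply' _ _ _ hs]
  rfl

/-- If `W` depends on the past `X` only, learning `W` does not change the conditional
distribution of `Y`. -/
theorem HasCondDistrib.prodMkRight_of_prodMkRight [SFinite P] {κ : Kernel 𝓧 𝓨}
    [IsMarkovKernel κ] {η : Kernel 𝓧 𝓦} [IsMarkovKernel η] (hY : HasCondDistrib Y X κ P)
    (hW : HasCondDistrib W (fun ω => (X ω, Y ω)) (η.prodMkRight 𝓨) P) :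
    HasCondDistrib Y (fun ω => (X ω, W ω)) (κ.prodMkRight 𝓦) P := by
  have h := (hY.compProd hW).comp_left measurable_swap
  refine HasCondDistrib.of_compProd (κ := η) ?_
  rwa [Kernel.compProd_prodMkRight, Kernel.map_prod_swap, ← Kernel.compProd_prodMkRight] at h

/-- A kernel `ρ` that does not distinguish `x` from `τ x` has a disintegration with the same
property. The composition with `τ` is needed because `condKernel` may take different values at
two points where `ρ` takes the same value. -/
theorem exists_condKernel_comap [Nonempty 𝓨] [StandardBorelSpace 𝓨]
    [MeasurableSpace.CountableOrCountablyGenerated 𝓧 𝓦] (ρ : Kernel 𝓧 (𝓦 × 𝓨))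
    [IsMarkovKernel ρ] {τ : 𝓧 → 𝓧} (hτ : Measurable τ) (hρ : ∀ x, ρ (τ x) = ρ x) :
    ∃ K : Kernel (𝓧 × 𝓦) 𝓨, IsMarkovKernel K ∧
      ρ.fst ⊗ₖ K.comap (Prod.map τ id) (hτ.prodMap measurable_id) = ρ := by
  refine ⟨ρ.condKernel, inferInstance, ?_⟩
  ext x s hs
  rw [Kernel.compProd_apply hs]
  conv_rhs => rw [← hρ, ← ρ.disintegrate ρ.condKernel, Kernel.compProd_apply hs]
  rw [Kernel.fst_apply, Kernel.fst_apply, hρ]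
  rfl

/-- If `U` with law `ν` is independent of `X`, then `F X U` has conditional distribution
`x ↦ law of F x U` given `X`. -/
theorem IndepFun.hasCondDistrib [IsProbabilityMeasure P] {U : Ω → 𝓦} (hXU : IndepFun X U P)
    (hX : Measurable X) (hU : Measurable U) {F : 𝓧 → 𝓦 → 𝓨}
    (hF : Measurable (Function.uncurry F)) {κ : Kernel 𝓧 𝓨} [IsSFiniteKernel κ]
    (hκ : ∀ x, κ x = (P.map U).map (F x)) :
    HasCondDistrib (fun ω => F (X ω) (U ω)) X κ P where
  aemeasurable := (hX.prodMk (hF.comp (hX.prodMk hU))).aemeasurable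
  map_eq := by
    have hg : Measurable (fun q : 𝓧 × 𝓦 => (q.1, F q.1 q.2)) := measurable_fst.prodMk hF
    have : IsProbabilityMeasure (P.map U) := Measure.isProbabilityMeasure_map hU.aemeasurable
    calc P.map (fun ω => (X ω, F (X ω) (U ω)))
        = (P.map (fun ω => (X ω, U ω))).map (fun q => (q.1, F q.1 q.2)) := by
          rw [Measure.map_map hg (hX.prodMk hU)]
          rfl
      _ = P.map X ⊗ₘ κ := by
          rw [hXU.map_prod_eq_prod_map_map hX.aemeasurable hU.aemeasurable]
          ext s hs
          rw [Measure.map_apply hg hs, Measure.prod_apply (hg hs), Measure.compProd_apply hs]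
          refine lintegral_congr fun x => ?_
          have hFx : Measurable (F x) := hF.comp measurable_prodMk_left
          rw [hκ, Measure.map_apply hFx (measurable_prodMk_left hs)]
          rfl

theorem HasCondDistrib.of_map {Ω' : Type*} {mΩ' : MeasurableSpace Ω'} {T : Ω' → Ω}
    {Q : Measure Ω'} (hT : Measurable T) (hX : Measurable X) (hY : Measurable Y)
    {κ : Kernel 𝓧 𝓨} (h : HasCondDistrib (fun ω => Y (T ω)) (fun ω => X (T ω)) κ Q) :
    HasCondDistrib Y X κ (Q.map T) where
  aemeasurable := (hX.prodMk hY).aemeasurable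
  map_eq := by
    rw [Measure.map_map (hX.prodMk hY) hT, Measure.map_map hX hT]
    exact h.map_eq

/-- Two versions of a conditional distribution agree almost surely. -/
theorem HasCondDistrib.ae_eq [IsFiniteMeasure P] [Nonempty 𝓨] [StandardBorelSpace 𝓨]
    {κ η : Kernel 𝓧 𝓨} [IsFiniteKernel κ] [IsFiniteKernel η] (hκ : HasCondDistrib Y X κ P)
    (hη : HasCondDistrib Y X η P) : κ =ᵐ[P.map X] η :=
  (condDistrib_ae_eq_of_measure_eq_compProd X hκ.aemeasurable_snd hκ.map_eq).symm.trans
    (condDistrib_ae_eq_of_measure_eq_compProd X hη.aemeasurable_snd hη.map_eq)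

/-- If `Z` is a function of `X`, then `Y` and `X` are conditionally independent given `Z` if and
only if the conditional distribution of `Y` given `X` depends on `Z` alone. -/
theorem condIndepFun_iff_exists_hasCondDistrib [IsProbabilityMeasure P] [StandardBorelSpace Ω]
    [Nonempty 𝓨] [StandardBorelSpace 𝓨] [Nonempty 𝓧] [StandardBorelSpace 𝓧]
    (hX : Measurable X) (hY : Measurable Y) {ψ : 𝓧 → 𝓩} (hψ : Measurable ψ) :
    CondIndepFun (m𝓩.comap (fun ω => ψ (X ω))) (hψ.comp hX).comap_le X Y P ↔
      ∃ κ : Kernel 𝓩 𝓨, IsMarkovKernel κ ∧ HasCondDistrib Y X (κ.comap ψ hψ) P := by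
  have hZ : Measurable (fun ω => ψ (X ω)) := hψ.comp hX
  rw [condIndepFun_iff_condDistrib_prod_ae_eq_prodMkRight hY hX hZ,
    condDistrib_ae_eq_iff_measure_eq_compProd _ hY.aemeasurable]
  constructor
  · intro h
    have h' : HasCondDistrib Y (fun ω => (ψ (X ω), X ω))
        ((condDistrib Y (fun ω => ψ (X ω)) P).prodMkRight 𝓧) P := ⟨by fun_prop, h⟩
    exact ⟨condDistrib Y (fun ω => ψ (X ω)) P, inferInstance,
      h'.of_comp (ψ := Prod.snd) measurable_snd (.of_forall fun ω => by simp)⟩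
  · rintro ⟨κ, hκ, h⟩
    have hZκ : HasCondDistrib Y (fun ω => ψ (X ω)) κ P :=
      h.of_comp hψ (.of_forall fun ω => by simp)
    have hae := ae_of_ae_map hZ.aemeasurable
      (condDistrib_ae_eq_of_measure_eq_compProd _ hY.aemeasurable hZκ.map_eq)
    refine (h.of_comp (ψ := fun x => (ψ x, x)) (hψ.prodMk measurable_id) ?_).map_eq
    filter_upwards [hae] with ω hω
    simpa using hω

end ProbabilityTheory

/-! ### Sequential posterior of the target -/

namespace SCM

variable {V : Type*} {𝒳 𝒰 : V → Type*}

open Classical in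
/-- The coordinates of `x` in `S`, completed by those of the reference point `x₀`. Information
about the coordinates in `S` is encoded in this way to keep all variables on one space. -/
noncomputable def truncate (x₀ : ∀ v, 𝒳 v) (S : Set V) (x : ∀ v, 𝒳 v) : ∀ v, 𝒳 v :=
  S.piecewise x x₀

theorem truncate_of_mem {x₀ x : ∀ v, 𝒳 v} {S : Set V} {v : V} (h : v ∈ S) :
    truncate x₀ S x v = x v := by
  classical exact Set.piecewise_eq_of_mem _ _ _ h

theorem truncate_of_notMem {x₀ x : ∀ v, 𝒳 v} {S : Set V} {v : V} (h : v ∉ S) :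
    truncate x₀ S x v = x₀ v := by
  classical exact Set.piecewise_eq_of_notMem _ _ _ h

theorem truncate_congr {x₀ x x' : ∀ v, 𝒳 v} {S : Set V} (h : ∀ v ∈ S, x v = x' v) :
    truncate x₀ S x = truncate x₀ S x' := by
  ext v
  by_cases hv : v ∈ S
  · rw [truncate_of_mem hv, truncate_of_mem hv, h v hv]
  · rw [truncate_of_notMem hv, truncate_of_notMem hv]

open Classical in
theorem truncate_insert {x₀ x : ∀ v, 𝒳 v} {S : Set V} {v : V} :
    truncate x₀ (insert v S) x = Function.update (truncate x₀ S x) v (x v) := by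
  ext w
  by_cases hw : w = v
  · subst hw; simp [truncate]
  · by_cases hS : w ∈ S <;> simp [truncate, hw, hS]

theorem _root_.DependsOn.truncate {α : Type*} {g : (∀ v, 𝒳 v) → α} {T : Set V}
    (hg : DependsOn g T) (x₀ x : ∀ v, 𝒳 v) : g (SCM.truncate x₀ T x) = g x :=
  hg fun _ hv => truncate_of_mem hv

variable [∀ v, MeasurableSpace (𝒳 v)] [∀ v, MeasurableSpace (𝒰 v)]

theorem measurable_equation (M : SCM 𝒳 𝒰) (v : V) :
    Measurable fun q : (∀ v, 𝒳 v) × 𝒰 v => M.f v (fun w => q.1 w) q.2 :=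
  (M.measurable_f v).comp (Measurable.prodMk
    (measurable_pi_lambda _ fun _ => (measurable_pi_apply _).comp measurable_fst)
    measurable_snd)

/-- The mechanism of `v`: the law of `f v (x u : u direct cause of v) (U v)`, as a kernel from
the configurations `x` of all variables. -/
noncomputable def mechanism (M : SCM 𝒳 𝒰) (v : V) : Kernel (∀ v, 𝒳 v) (𝒳 v) where
  toFun x := (M.noise v).map (fun t => M.f v (fun w => x w) t)
  measurable' := by
    refine Measure.measurable_of_measurable_coe _ fun s hs => ?_
    have h (x : ∀ v, 𝒳 v) : (M.noise v).map (fun t => M.f v (fun w => x w) t) s =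
        M.noise v (Prod.mk x ⁻¹' ((fun q : (∀ v, 𝒳 v) × 𝒰 v =>
          M.f v (fun w => q.1 w) q.2) ⁻¹' s)) :=
      Measure.map_apply ((M.measurable_equation v).comp measurable_prodMk_left) hs
    simp_rw [h]
    exact measurable_measure_prodMk_left (M.measurable_equation v hs)

theorem mechanism_apply (M : SCM 𝒳 𝒰) (v : V) (x : ∀ v, 𝒳 v) :
    M.mechanism v x = (M.noise v).map (fun t => M.f v (fun w => x w) t) := rfl

instance (M : SCM 𝒳 𝒰) (v : V) : IsMarkovKernel (M.mechanism v) :=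
  ⟨fun _ => Measure.isProbabilityMeasure_map
    ((M.measurable_equation v).comp measurable_prodMk_left).aemeasurable⟩

theorem dependsOn_mechanism (M : SCM 𝒳 𝒰) (v : V) :
    DependsOn (M.mechanism v) (CausalGraph.directCauses M.graph v) := by
  intro x x' h
  have : (fun w : CausalGraph.directCauses M.graph v => x w) =
      fun w : CausalGraph.directCauses M.graph v => x' w := funext fun w => h w w.2
  simp only [mechanism_apply, this]

theorem mechanism_act (M : SCM 𝒳 𝒰) (a : DoAction 𝒳) {v : V} (hv : v ∉ a.targets) :
    (M.act a).mechanism v = M.mechanism v := by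
  ext1 x
  simp only [mechanism_apply, act, hv, dite_false]

theorem measurable_truncate (x₀ : ∀ v, 𝒳 v) (S : Set V) : Measurable (truncate x₀ S) := by
  refine measurable_pi_lambda _ fun v => ?_
  by_cases h : v ∈ S
  · simpa only [truncate_of_mem h] using measurable_pi_apply v
  · simpa only [truncate_of_notMem h] using measurable_const

theorem measurable_update_pair [DecidableEq V] (v : V) :
    Measurable fun q : (∀ w, 𝒳 w) × 𝒳 v => Function.update q.1 v q.2 :=
  measurable_update'

/-- `M'` has no edges beyond those of `M`, and the same mechanisms as `M` at `y` and at the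
children of `y` in `M`. -/
structure SharesMechanisms (M M' : SCM 𝒳 𝒰) (y : V) : Prop where
  adj : ∀ u v, M'.graph.Adj u v → M.graph.Adj u v
  mechanism_target : M'.mechanism y = M.mechanism y
  mechanism_child : ∀ v, M.graph.Adj y v → M'.mechanism v = M.mechanism v

theorem SharesMechanisms.refl (M : SCM 𝒳 𝒰) (y : V) : M.SharesMechanisms M y :=
  ⟨fun _ _ h => h, rfl, fun _ _ => rfl⟩

theorem sharesMechanisms_act (M : SCM 𝒳 𝒰) {y : V} {a : DoAction 𝒳}
    (ha : a.targets ⊆ CausalGraph.causes M.graph y) : M.SharesMechanisms (M.act a) y where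
  adj _ _ h := h.1
  mechanism_target := M.mechanism_act a fun h => M.acyclic.not_mem_causes y (ha h)
  mechanism_child _ hv := M.mechanism_act a fun h => M.acyclic.child_not_mem_causes hv (ha h)

variable [Fintype V]

theorem solve_congr (M : SCM 𝒳 𝒰) {S : Set V} (hS : ∀ u v, M.graph.Adj u v → v ∈ S → u ∈ S)
    {u u' : ∀ v, 𝒰 v} (h : ∀ v ∈ S, u v = u' v) : ∀ v ∈ S, M.solve u v = M.solve u' v := by
  intro v
  induction v using M.wellFounded_adj.induction with
  | _ v ih =>
    intro hv
    rw [M.solve_eq u, M.solve_eq u', h v hv]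
    congr 1
    exact funext fun w => ih w w.2 (hS w v w.2 hv)

open Classical in
/-- The local Markov property: given a set `S` of variables that is closed under parents and
contains the parents of `v ∉ S`, the variable `X_v` is distributed according to its mechanism. -/
theorem hasCondDistrib_mechanism (M : SCM 𝒳 𝒰) (x₀ : ∀ v, 𝒳 v) {S : Set V}
    (hS : ∀ u v, M.graph.Adj u v → v ∈ S → u ∈ S) {v : V} (hv : v ∉ S)
    (hpa : CausalGraph.directCauses M.graph v ⊆ S) :
    HasCondDistrib (fun x => x v) (truncate x₀ S) (M.mechanism v) M.law := by
  refine HasCondDistrib.of_map M.measurable_solve (measurable_truncate x₀ S)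
    (measurable_pi_apply v) ?_
  set A : (∀ v, 𝒰 v) → ∀ v, 𝒳 v := fun u => truncate x₀ S (M.solve u)
  have hAm : Measurable A := (measurable_truncate x₀ S).comp M.measurable_solve
  obtain ⟨u₀⟩ : Nonempty (∀ v, 𝒰 v) := nonempty_of_isProbabilityMeasure (Measure.pi M.noise)
  -- `A` does not involve the noise at `v`: it is unchanged when `u v` is replaced by `u₀ v`
  have hind : IndepFun A (fun u => u v) (Measure.pi M.noise) := by
    have h := (iIndepFun_pi (μ := M.noise) (X := fun _ => id)
      (fun _ => aemeasurable_id)).indepFun_finset {v}ᶜ {v} disjoint_compl_left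
      (fun i => measurable_pi_apply i)
    let e : (∀ i : ({v}ᶜ : Finset V), 𝒰 i) → ∀ i, 𝒰 i := fun q i =>
      if hi : i ∈ ({v}ᶜ : Finset V) then q ⟨i, hi⟩ else u₀ i
    have he : Measurable e := by
      refine measurable_pi_lambda _ fun i => ?_
      by_cases hi : i ∈ ({v}ᶜ : Finset V)
      · simpa only [e, hi, dite_true] using measurable_pi_apply _
      · simpa only [e, hi, dite_false] using measurable_const
    have h' := h.comp (hAm.comp he) (measurable_pi_apply (⟨v, by simp⟩ : ({v} : Finset V)))
    convert! h' using 1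
    funext u
    refine truncate_congr (M.solve_congr hS fun w hw => ?_)
    have hwv : w ≠ v := fun h => hv (h ▸ hw)
    simp [e, hwv]
  have hmap : (Measure.pi M.noise).map (fun u => u v) = M.noise v :=
    (measurePreserving_eval M.noise v).map_eq
  have key := IndepFun.hasCondDistrib (F := fun x t => M.f v (fun w => x w) t)
    (κ := M.mechanism v) hind hAm (measurable_pi_apply v) (M.measurable_equation v)
    (fun x => by rw [hmap, mechanism_apply])
  convert! key using 1
  funext u
  rw [M.solve_eq]
  congr 1
  exact funext fun w => (truncate_of_mem (hpa w.2)).symm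

variable [∀ v, StandardBorelSpace (𝒳 v)]

open Classical CausalGraph in
/-- One vertex `v` is added to the past `S`. If `v` is not a child of `y`, it carries no new
information on `X_y`; if it is, the joint conditional law of `X_y` and `X_v`, which depends on
the coordinates in the Markov blanket only, is disintegrated. -/
theorem exists_kernel_insert (M : SCM 𝒳 𝒰) (x₀ : ∀ v, 𝒳 v) {y v : V} {S : Set V} (hyS : y ∈ S)
    (hS : ∀ u v, M.graph.Adj u v → v ∈ S → u ∈ S) (hv : v ∉ S)
    (hpa : directCauses M.graph v ⊆ S) (π : Kernel (∀ v, 𝒳 v) (𝒳 y)) [IsMarkovKernel π]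
    (hπ : DependsOn π (markovBlanket M.graph y ∩ S))
    (hM : ∀ M', M.SharesMechanisms M' y →
      HasCondDistrib (fun x => x y) (truncate x₀ (S \ {y})) π M'.law) :
    ∃ π' : Kernel (∀ v, 𝒳 v) (𝒳 y), IsMarkovKernel π' ∧
      DependsOn π' (markovBlanket M.graph y ∩ insert v S) ∧
      ∀ M', M.SharesMechanisms M' y →
        HasCondDistrib (fun x => x y) (truncate x₀ (insert v S \ {y})) π' M'.law := by
  have hvy : v ≠ y := fun h => hv (h ▸ hyS)
  have hins : insert v S \ {y} = insert v (S \ {y}) := by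
    ext w; simp only [Set.mem_sdiff, Set.mem_insert_iff, Set.mem_singleton_iff]; grind
  have htr : truncate x₀ (insert v S \ {y}) =
      fun x => Function.update (truncate x₀ (S \ {y}) x) v (x v) := by
    rw [hins]
    exact funext fun x => truncate_insert
  have hyins : insert y (S \ {y}) = S := by
    ext w; simp only [Set.mem_sdiff, Set.mem_insert_iff, Set.mem_singleton_iff]; grind
  -- the law of `X_v` given `X_y` and the rest of the past
  have hlocal : ∀ M', M.SharesMechanisms M' y → HasCondDistrib (fun x => x v)
      (fun x => (truncate x₀ (S \ {y}) x, x y))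
      ((M'.mechanism v).comap _ (measurable_update_pair y)) M'.law := by
    intro M' h'
    have h := M'.hasCondDistrib_mechanism x₀ (fun u w h => hS u w (h'.adj u w h)) hv
      (fun u h => hpa (h'.adj u v h))
    refine cast ?_ (h.of_comp (ψ := fun x => (truncate x₀ (S \ {y}) x, x y))
      (κ' := (M'.mechanism v).comap _ (measurable_update_pair y))
      ((measurable_truncate _ _).prodMk (measurable_pi_apply y)) (.of_forall fun x => ?_))
    · congr 1
      funext x
      rw [truncate_of_mem hyS, truncate_congr (x' := x)]
      exact fun w hw => truncate_of_mem hw.1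
    · rw [Kernel.comap_apply]
      congr 1
      rw [← truncate_insert, hyins]
      exact truncate_congr fun w hw => truncate_of_mem hw
  by_cases hch : M.graph.Adj y v
  · -- the joint conditional law of `X_v` and `X_y`
    set ρ : Kernel (∀ v, 𝒳 v) (𝒳 v × 𝒳 y) :=
      (π ⊗ₖ (M.mechanism v).comap _ (measurable_update_pair y)).map Prod.swap with hρdef
    have : IsMarkovKernel ρ := Kernel.IsMarkovKernel.map _ measurable_swap
    have hρ : DependsOn ρ (markovBlanket M.graph y ∩ S) := by
      intro x x' h
      have hmech (t : 𝒳 y) : M.mechanism v (Function.update x y t) =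
          M.mechanism v (Function.update x' y t) := by
        refine M.dependsOn_mechanism v fun w hw => ?_
        by_cases hwy : w = y
        · subst hwy; simp
        · rw [Function.update_of_ne hwy, Function.update_of_ne hwy]
          exact h w ⟨Or.inr ⟨hwy, v, hch, hw⟩, hpa hw⟩
      have : (π ⊗ₖ (M.mechanism v).comap _ (measurable_update_pair y)) x =
          (π ⊗ₖ (M.mechanism v).comap _ (measurable_update_pair y)) x' := by
        ext s hs
        rw [Kernel.compProd_apply hs, Kernel.compProd_apply hs, hπ h]
        simp only [Kernel.comap_apply, hmech]
      rw [hρdef, Kernel.map_apply _ measurable_swap, Kernel.map_apply _ measurable_swap, this]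
    have : Nonempty (𝒳 y) := ⟨x₀ y⟩
    obtain ⟨K, hK, hKρ⟩ := exists_condKernel_comap ρ
      (measurable_truncate x₀ (markovBlanket M.graph y ∩ S)) (fun x => hρ.truncate x₀ x)
    have hm : Measurable fun x : ∀ v, 𝒳 v =>
        (truncate x₀ (markovBlanket M.graph y ∩ S) x, x v) :=
      (measurable_truncate _ _).prodMk (measurable_pi_apply v)
    refine ⟨K.comap _ hm, inferInstance, ?_, fun M' h' => ?_⟩
    · intro x x' h
      rw [Kernel.comap_apply, Kernel.comap_apply,
        truncate_congr fun w hw => h w ⟨hw.1, Or.inr hw.2⟩,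
        h v ⟨Or.inl (Or.inr hch), Or.inl rfl⟩]
    · have hloc := hlocal M' h'
      rw [h'.mechanism_child v hch] at hloc
      have hjoint := ((hM M' h').compProd hloc).comp_left measurable_swap
      rw [← hρdef, ← hKρ] at hjoint
      have hpost := HasCondDistrib.of_compProd hjoint
      rw [htr]
      refine hpost.of_comp (measurable_update_pair v) (.of_forall fun x => ?_)
      rw [Kernel.comap_apply, Kernel.comap_apply]
      congr 1
      refine Prod.ext (truncate_congr fun w hw => ?_) (by simp)
      have hwv : w ≠ v := fun h => hv (h ▸ hw.2)
      simp [hwv]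
  · refine ⟨π, inferInstance, fun x x' h => hπ fun w hw => h w ⟨hw.1, Or.inr hw.2⟩,
      fun M' h' => ?_⟩
    have hloc := hlocal M' h'
    have hmech : (M'.mechanism v).comap _ (measurable_update_pair y) =
        (M'.mechanism v).prodMkRight (𝒳 y) := by
      ext1 q
      rw [Kernel.comap_apply, Kernel.prodMkRight_apply]
      refine M'.dependsOn_mechanism v fun w hw => Function.update_of_ne ?_ _ _
      rintro rfl
      exact hch (h'.adj _ _ hw)
    rw [hmech] at hloc
    have hpost := (hM M' h').prodMkRight_of_prodMkRight hloc
    rw [htr]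
    refine hpost.of_comp (measurable_update_pair v) (.of_forall fun x => ?_)
    rw [Kernel.prodMkRight_apply]
    refine hπ fun w hw => Function.update_of_ne ?_ _ _
    rintro rfl
    exact hv hw.2

open CausalGraph in
/-- A conditional distribution of `X_y` given all other variables that is a function of the Markov
blanket, and the same one for all models that share the mechanisms of `y` and its children.
It is built along a topological order of the graph, starting with the causes of `y`. -/
theorem exists_kernel_markovBlanket (M : SCM 𝒳 𝒰) (x₀ : ∀ v, 𝒳 v) (y : V) :
    ∃ π : Kernel (∀ v, 𝒳 v) (𝒳 y), IsMarkovKernel π ∧ DependsOn π (markovBlanket M.graph y) ∧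
      ∀ M', M.SharesMechanisms M' y →
        HasCondDistrib (fun x => x y) (truncate x₀ {y}ᶜ) π M'.law := by
  have grow : ∀ S : Set V, y ∈ S → (∀ u v, M.graph.Adj u v → v ∈ S → u ∈ S) →
      (∃ π : Kernel (∀ v, 𝒳 v) (𝒳 y), IsMarkovKernel π ∧
        DependsOn π (markovBlanket M.graph y ∩ S) ∧
        ∀ M', M.SharesMechanisms M' y →
          HasCondDistrib (fun x => x y) (truncate x₀ (S \ {y})) π M'.law) →
      ∃ π : Kernel (∀ v, 𝒳 v) (𝒳 y), IsMarkovKernel π ∧ DependsOn π (markovBlanket M.graph y) ∧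
        ∀ M', M.SharesMechanisms M' y →
          HasCondDistrib (fun x => x y) (truncate x₀ {y}ᶜ) π M'.law := by
    intro S
    induction S using WellFoundedGT.induction with
    | _ S ih =>
      intro hyS hS hex
      obtain ⟨π, hπ, hdep, hM⟩ := hex
      by_cases huniv : S = Set.univ
      · subst huniv
        refine ⟨π, hπ, by simpa using hdep, fun M' h' => ?_⟩
        rw [Set.compl_eq_univ_sdiff]
        exact hM M' h'
      · obtain ⟨v, hv, hmin⟩ := M.wellFounded_adj.has_min Sᶜ (Set.nonempty_compl.2 huniv)
        have hpa : directCauses M.graph v ⊆ S := fun u hu => by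
          by_contra h
          exact hmin u h hu
        refine ih (insert v S) (Set.ssubset_insert hv) (Or.inr hyS) ?_
          (M.exists_kernel_insert x₀ hyS hS hv hpa π hdep hM)
        rintro u w huw (rfl | hw)
        · exact Or.inr (hpa huw)
        · exact Or.inr (hS u w huw hw)
  have hclosed : ∀ u v, M.graph.Adj u v → v ∈ causes M.graph y → u ∈ causes M.graph y :=
    fun u v h hv => .head h hv
  have hsub := directCauses_subset_causes M.graph y
  refine grow (insert y (causes M.graph y)) (Or.inl rfl) ?_ ⟨M.mechanism y, inferInstance, ?_, ?_⟩
  · rintro u w huw (rfl | hw)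
    · exact Or.inr (hsub huw)
    · exact Or.inr (hclosed u w huw hw)
  · exact fun x x' h => M.dependsOn_mechanism y fun w hw =>
      h w ⟨Or.inl (Or.inl hw), Or.inr (hsub hw)⟩
  · intro M' h'
    have hy := M.acyclic.not_mem_causes y
    rw [Set.insert_sdiff_self_of_notMem hy, ← h'.mechanism_target]
    exact M'.hasCondDistrib_mechanism x₀ (fun u w h => hclosed u w (h'.adj u w h)) hy
      (fun u h => hsub (h'.adj u y h))

end SCM

/-! ### Conditional independence and invariance -/

namespace SCM

variable {V : Type*} {𝒳 𝒰 : V → Type*} [∀ v, MeasurableSpace (𝒳 v)] [∀ v, MeasurableSpace (𝒰 v)]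

theorem measurable_restrict_subset {B S : Set V} (h : B ⊆ S) :
    Measurable (fun (z : ∀ s : S, 𝒳 s) (b : B) => z ⟨b, h b.2⟩) :=
  measurable_pi_lambda _ fun _ => measurable_pi_apply _

open Classical in
/-- The point with coordinates `z` in `S` and those of the reference point `x₀` elsewhere. -/
noncomputable def extend (x₀ : ∀ v, 𝒳 v) (S : Set V) (z : ∀ s : S, 𝒳 s) : ∀ v, 𝒳 v :=
  fun v => if h : v ∈ S then z ⟨v, h⟩ else x₀ v

theorem measurable_extend (x₀ : ∀ v, 𝒳 v) (S : Set V) : Measurable (extend x₀ S) := by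
  refine measurable_pi_lambda _ fun v => ?_
  by_cases h : v ∈ S
  · simpa only [extend, h, dite_true] using measurable_pi_apply _
  · simpa only [extend, h, dite_false] using measurable_const

variable [Fintype V]

/-- Empty value spaces are excluded by the existence of the noise distributions. -/
theorem nonempty_configuration (M : SCM 𝒳 𝒰) : Nonempty (∀ v, 𝒳 v) :=
  nonempty_of_isProbabilityMeasure M.law

variable [∀ v, StandardBorelSpace (𝒳 v)]

open CausalGraph in
/-- One kernel is a conditional distribution of `X_y` given `X_S`, for every `S` that contains the
Markov blanket but not `y`, and in every model that shares the mechanisms of `y` and its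
children. -/
theorem exists_kernel_restrict_markovBlanket (M : SCM 𝒳 𝒰) (y : V) :
    ∃ κ : Kernel (∀ b : markovBlanket M.graph y, 𝒳 b) (𝒳 y), IsMarkovKernel κ ∧
      ∀ M', M.SharesMechanisms M' y → ∀ (S : Set V) (hS : markovBlanket M.graph y ⊆ S), y ∉ S →
        HasCondDistrib (fun x : ∀ v, 𝒳 v => x y) (Set.domRestrict (π := 𝒳) S)
          (κ.comap _ (measurable_restrict_subset hS)) M'.law := by
  obtain ⟨x₀⟩ := M.nonempty_configuration
  obtain ⟨π, hπ, hdep, hM⟩ := M.exists_kernel_markovBlanket x₀ y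
  refine ⟨π.comap _ (measurable_extend x₀ _), inferInstance, fun M' h' S hS hy => ?_⟩
  have hres : Set.domRestrict (π := 𝒳) S = fun x => Set.domRestrict S (truncate x₀ {y}ᶜ x) := by
    funext x s
    -- the target, which is the only coordinate lost, is not in `S`
    exact (truncate_of_mem (S := {y}ᶜ) (ne_of_mem_of_not_mem s.2 hy)).symm
  rw [hres]
  refine (hM M' h').of_comp (measurable_domRestrict S) (.of_forall fun x => ?_)
  rw [Kernel.comap_apply, Kernel.comap_apply]
  exact hdep fun v hv => by simp [extend, hv]

/-- For `B ⊆ O`, the variables `X_O` and `X_y` are conditionally independent given `X_B` if and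
only if `X_y` has a conditional distribution given `X_O` that is a function of `X_B`. -/
theorem condIndep_iff_exists_hasCondDistrib (M : SCM 𝒳 𝒰) {O B : Set V} (hB : B ⊆ O) (y : V) :
    M.CondIndep O {y} B ↔ ∃ κ : Kernel (∀ b : B, 𝒳 b) (𝒳 y), IsMarkovKernel κ ∧
      HasCondDistrib (fun x : ∀ v, 𝒳 v => x y) (Set.domRestrict (π := 𝒳) O)
        (κ.comap _ (measurable_restrict_subset hB)) M.law := by
  obtain ⟨x₀⟩ := M.nonempty_configuration
  have : Nonempty (𝒳 y) := ⟨x₀ y⟩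
  have : Nonempty (∀ o : O, 𝒳 o) := ⟨fun o => x₀ o⟩
  rw [← condIndepFun_iff_exists_hasCondDistrib (measurable_domRestrict O) (measurable_pi_apply y)
    (measurable_restrict_subset hB)]
  -- `X_y` and the one-element family `X_{y}` carry the same information
  let e := MeasurableEquiv.piUnique (fun s : ({y} : Set V) => 𝒳 s)
  have he : Set.domRestrict (π := 𝒳) {y} = e.symm ∘ fun x => x y :=
    funext fun x => (e.symm_apply_apply _).symm
  refine ⟨fun h => CondIndepFun.comp h measurable_id e.measurable, fun h => ?_⟩
  unfold CondIndep
  rw [he]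
  exact CondIndepFun.comp h measurable_id e.symm.measurable

theorem CondIndep.mono_left {M : SCM 𝒳 𝒰} {A A' C B : Set V} (h : M.CondIndep A C B)
    (hA : A' ⊆ A) : M.CondIndep A' C B :=
  CondIndepFun.comp h (measurable_restrict_subset hA) measurable_id

theorem condIndep_markovBlanket (M : SCM 𝒳 𝒰) {y : V} {O : Set V} (hy : y ∉ O)
    (hO : CausalGraph.markovBlanket M.graph y ⊆ O) :
    M.CondIndep O {y} (CausalGraph.markovBlanket M.graph y) := by
  obtain ⟨κ, hκ, h⟩ := M.exists_kernel_restrict_markovBlanket y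
  exact (M.condIndep_iff_exists_hasCondDistrib hO y).2 ⟨κ, hκ, h M (.refl M y) O hO hy⟩

/-- In a faithful model the probabilistic Markov blanket consists of the parents, children and
spouses. -/
theorem IsMarkovBlanket.eq_markovBlanket {M : SCM 𝒳 𝒰} {y : V} {O B : Set V} (hy : y ∉ O)
    (hO : CausalGraph.markovBlanket M.graph y ⊆ O) (hB : M.IsMarkovBlanket O y B)
    (hM : M.Faithful) : B = CausalGraph.markovBlanket M.graph y := by
  have hsep : CausalGraph.DSep M.graph (O \ B) {y} B :=
    hM _ _ _ (Set.disjoint_singleton_right.2 fun h => hy h.1) Set.disjoint_sdiff_left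
      (Set.disjoint_singleton_left.2 fun h => hy (hB.prop.1 h))
      (hB.prop.2.mono_left Set.sdiff_subset)
  have hsub := CausalGraph.markovBlanket_subset_of_dSep M.acyclic hO hsep
  exact (hB.le_of_le ⟨hO, M.condIndep_markovBlanket hy hO⟩ hsub).antisymm hsub

theorem invariantConditional_markovBlanket (M : SCM 𝒳 𝒰) (y : V) :
    M.InvariantConditional {a | a.targets ⊆ CausalGraph.causes M.graph y} y
      (CausalGraph.markovBlanket M.graph y) := by
  obtain ⟨κ, hκ, h⟩ := M.exists_kernel_restrict_markovBlanket y
  exact ⟨κ, hκ, fun a ha => h _ (M.sharesMechanisms_act ha) _ subset_rfl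
    (CausalGraph.not_mem_markovBlanket M.acyclic y)⟩

/-- Before the action, the conditional distributions of `X_y` given `X_B` and given the parents,
children and spouses are both versions of the one given `X_O`, so they agree almost surely; by
absolute continuity they still do after the action, where the second one remains valid. -/
theorem invariantConditional_of_condIndep (M : SCM 𝒳 𝒰) {y : V} {O B : Set V} (hy : y ∉ O)
    (hO : CausalGraph.markovBlanket M.graph y ⊆ O) (hB : B ⊆ O) (h : M.CondIndep O {y} B) :
    M.InvariantConditional
      {a | a.targets ⊆ CausalGraph.causes M.graph y ∧
        (M.act a).law.map (Set.domRestrict (π := 𝒳) O) ≪ M.law.map (Set.domRestrict (π := 𝒳) O)}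
      y B := by
  obtain ⟨x₀⟩ := M.nonempty_configuration
  have : Nonempty (𝒳 y) := ⟨x₀ y⟩
  obtain ⟨η, hη, hηB⟩ := (M.condIndep_iff_exists_hasCondDistrib hB y).1 h
  obtain ⟨κ, hκ, hκM⟩ := M.exists_kernel_restrict_markovBlanket y
  refine ⟨η, hη, fun a ha => ?_⟩
  -- under the action, the kernels `η (X_B)` and `κ (X_blanket)` agree almost surely
  have hae := ae_of_ae_map (measurable_domRestrict O).aemeasurable
    (ha.2.ae_le (hηB.ae_eq (hκM M (.refl M y) O hO hy)))
  refine (hκM _ (M.sharesMechanisms_act ha.1) O hO hy).of_comp (measurable_restrict_subset hB) ?_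
  filter_upwards [hae] with x hx
  exact hx

end SCM

theorem proposition1 {V : Type*} [Fintype V] {𝒳 𝒰 : V → Type*}
    [∀ v, MeasurableSpace (𝒳 v)] [∀ v, StandardBorelSpace (𝒳 v)] [∀ v, MeasurableSpace (𝒰 v)]
    (M : SCM 𝒳 𝒰) (y : V) (O : Set V) (hy : y ∉ O)
    (hcauses : CausalGraph.directCauses M.graph y ⊆ O)
    (hchildren : CausalGraph.directChildren M.graph y ⊆ O)
    (hspouses : CausalGraph.spouses M.graph y ⊆ O) :
    -- the Markov blanket as a minimal d-separating set
    (∀ B : Set V, CausalGraph.IsGraphicalMarkovBlanket M.graph O y B →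
      (∀ I ⊆ CausalGraph.causes M.graph y, CausalGraph.InterventionStable M.graph I y B) ∧
      M.InvariantConditional {a | a.targets ⊆ CausalGraph.causes M.graph y} y B) ∧
    -- the Markov blanket through conditional independence, in a faithful model
    (∀ B : Set V, M.IsMarkovBlanket O y B → M.Faithful →
      (∀ I ⊆ CausalGraph.causes M.graph y, CausalGraph.InterventionStable M.graph I y B) ∧
      M.InvariantConditional {a | a.targets ⊆ CausalGraph.causes M.graph y} y B) ∧
    -- the Markov blanket through conditional independence, in an arbitrary model, for the actions
    -- that do not leave the support of the observed variables
    (∀ B : Set V, M.IsMarkovBlanket O y B →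
      M.InvariantConditional
        {a | a.targets ⊆ CausalGraph.causes M.graph y ∧
          (M.act a).law.map (Set.domRestrict (π := 𝒳) O) ≪ M.law.map (Set.domRestrict (π := 𝒳) O)}
        y B) := by

  have hO : CausalGraph.markovBlanket M.graph y ⊆ O :=
    Set.union_subset (Set.union_subset hcauses hchildren) hspouses
  refine ⟨fun B hB => ?_, fun B hB hM => ?_, fun B hB =>
    M.invariantConditional_of_condIndep hy hO hB.prop.1 hB.prop.2⟩
  · obtain rfl := hB.eq_markovBlanket M.acyclic hy hO
    exact ⟨fun I hI => CausalGraph.interventionStable_markovBlanket M.acyclic hI,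
      M.invariantConditional_markovBlanket y⟩
  · obtain rfl := hB.eq_markovBlanket hy hO hM
    exact ⟨fun I hI => CausalGraph.interventionStable_markovBlanket M.acyclic hI,
      M.invariantConditional_markovBlanket y⟩
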